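/- Let $N\ge 2$ be an integer and let $\phi:(0,+\infty)\to[0,+\infty)$ be continuous and strictly decreasing with $\lim_{t\to0^+}\phi(t)=+\infty$; put $\phi(0)=+\infty$. For $d\ge1$ and a Borel probability measure $\rho$ on $\mathbb R^d$ let $\Pi(\rho)$ be the set of Borel probability measures on $(\mathbb R^d)^N$ all of whose $N$ marginals on $\mathbb R^d$ are equal to $\rho$, and let $$C(\rho)=\inf_{P\in\Pi(\rho)}\int_{(\mathbb R^d)^N}\ \sum_{1\le i<j\le N}\phi(|x_i-x_j|)\,dP(x_1,\dots,x_N)\in[0,+\infty].$$ A probability density $\rho$ on $\mathbb R^d$ (that is, $\rho\in L^1(\mathbb R^d)$, $\rho\ge0$, $\int\rho\,dx=1$) is identified with the measure $\rho\,dx$. (i) Let $d\ge1$, $1<p\le\infty$, and let $S$ be a set of probability densities on $\mathbb R^d$ with $\sup_{\rho\in S}\|\rho\|_{L^p}<\infty$. Then $C$ is finite on $S$ and Lipschitz continuous on $S$ for the $L^1$ distance: there is a constant $K$ such that $|C(\rho_1)-C(\rho_2)|\le K\|\rho_1-\rho_2\|_{L^1}$ for all $\rho_1,\rho_2\in S$.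 (ii) Let $\mathcal H=\{\rho\in L^1(\mathbb R^3):\rho\ge0,\ \sqrt\rho\in H^1(\mathbb R^3),\ \int\rho\,dx=1\}$, and let $S\subset\mathcal H$ satisfy $\sup_{\rho\in S}\|\sqrt\rho\|_{H^1}<\infty$. Then $C$ is finite on $S$, and there is a constant $K$ such that $|C(\rho_1)-C(\rho_2)|\le K\|\rho_1-\rho_2\|_{L^1}$ for all $\rho_1,\rho_2\in S$. -/

import Mathlib

open MeasureTheory Set Filter Topology
open scoped ENNReal NNReal ContDiff

noncomputable section

namespace RepulsiveTransport

/-- The Euclidean space `ℝ^d`. -/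
abbrev Space (d : ℕ) : Type := EuclideanSpace ℝ (Fin d)

/-- The class of repulsive pair potentials: `φ : (0, ∞) → [0, ∞)` is continuous, strictly
decreasing, and tends to `+∞` at `0+`. Values of `φ` outside `(0, ∞)` are never used. -/
structure IsRepulsivePotential (φ : ℝ → ℝ) : Prop where
  continuousOn : ContinuousOn φ (Ioi 0)
  nonneg : ∀ t, 0 < t → 0 ≤ φ t
  tendsto_zero : Tendsto φ (𝓝[>] 0) atTop
  strictAntiOn : StrictAntiOn φ (Ioi 0)

/-- The pair interaction `φ(|x - y|)`, equal to `φ(0+) = +∞` if `x = y`. -/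
def pairCost {d : ℕ} (φ : ℝ → ℝ) (x y : Space d) : ℝ≥0∞ :=
  open Classical in if x = y then ⊤ else ENNReal.ofReal (φ ‖x - y‖)

/-- The cost `c(x₁, …, x_N) = ∑_{i < j} φ(|x_i - x_j|)`. -/
def cost {d : ℕ} (N : ℕ) (φ : ℝ → ℝ) (x : Fin N → Space d) : ℝ≥0∞ :=
  ∑ q : Fin N × Fin N with q.1 < q.2, pairCost φ (x q.1) (x q.2)

/-- The set `Π(ρ)` of transport plans: probabilities on `(ℝ^d)^N` all of whose `N` marginals
are equal to `ρ`. -/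
def plans {d : ℕ} (N : ℕ) (ρ : Measure (Space d)) : Set (Measure (Fin N → Space d)) :=
  {P | IsProbabilityMeasure P ∧ ∀ i : Fin N, P.map (fun x => x i) = ρ}

/-- The multimarginal transport cost `C(ρ)`, with values in `[0, ∞]`. -/
def transportCost {d : ℕ} (N : ℕ) (φ : ℝ → ℝ) (ρ : Measure (Space d)) : ℝ≥0∞ :=
  ⨅ P ∈ plans N ρ, ∫⁻ x, cost N φ x ∂P

/-- The absolutely continuous probabilities on `ℝ^d`, as a subset of `L¹(ℝ^d)`. -/
def probDensities (d : ℕ) : Set (Lp ℝ 1 (volume : Measure (Space d))) :=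
  {ρ | 0 ≤ ρ ∧ ∫ x, ρ x = 1}

/-- The measure `ρ(x) dx`. -/
def densityMeasure {d : ℕ} (ρ : Lp ℝ 1 (volume : Measure (Space d))) : Measure (Space d) :=
  volume.withDensity (fun x => ENNReal.ofReal (ρ x))

/-- The functional `C` on densities. -/
def densityCost {d : ℕ} (N : ℕ) (φ : ℝ → ℝ) (ρ : Lp ℝ 1 (volume : Measure (Space d))) : ℝ≥0∞ :=
  transportCost N φ (densityMeasure ρ)

/-- `G` is the weak gradient of `u` on `ℝ^d`. -/
structure IsWeakGradient {d : ℕ} (u : Space d → ℝ) (G : Space d → Space d) : Prop where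
  locallyIntegrable : LocallyIntegrable u volume
  locallyIntegrable_grad : LocallyIntegrable G volume
  integral_eq : ∀ ψ : Space d → ℝ, ContDiff ℝ ∞ ψ → HasCompactSupport ψ → ∀ v : Space d,
    ∫ x, u x * fderiv ℝ ψ x v = -∫ x, ψ x * inner ℝ (G x) v

/-- `u ∈ H¹(ℝ^d)`. -/
def MemH1 {d : ℕ} (u : Space d → ℝ) : Prop :=
  MemLp u 2 volume ∧ ∃ G, IsWeakGradient u G ∧ MemLp G 2 volume

/-- The norm `‖u‖_{H¹} = (‖u‖₂² + ‖∇u‖₂²)^{1/2}`, equal to `+∞` if `u` is not in `H¹`. The weak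
gradient is unique up to null sets, so that the infimum is over equal numbers. -/
def eH1Norm {d : ℕ} (u : Space d → ℝ) : ℝ≥0∞ :=
  ⨅ (G : Space d → Space d) (_ : IsWeakGradient u G),
    (eLpNorm u 2 volume ^ 2 + eLpNorm G 2 volume ^ 2) ^ (1 / 2 : ℝ)

/-- The set `H` of densities `ρ ∈ L¹(ℝ³)` with `ρ ≥ 0`, `√ρ ∈ H¹(ℝ³)` and `∫ ρ = 1`. -/
def dftDensities : Set (Lp ℝ 1 (volume : Measure (Space 3))) :=
  {ρ | 0 ≤ ρ ∧ MemH1 (fun x => √(ρ x)) ∧ ∫ x, ρ x = 1}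

end RepulsiveTransport

end

/-! Both bounds on `S` are used only through non-concentration: for some `r > 0`, every density in
`S` gives mass at most `1/(8N)` to each ball of radius `r`. Given such an `r`, let `μ` be a common
part of `ρ₁` and `ρ₂`, and `P` a plan of `ρ₁`. Thinning `P` by the product of the values of `dμ/dρ₁`
at the `N` points leaves `Q ≤ P` with marginals below `μ`, at a loss of at most `N` times the mass
that `μ` misses (`exists_partial_plan`). The missing marginals of `ρ₂` are filled in by a multiple
`T` of a product measure, whose cost may be infinite. It is repaired one coordinate at a time, by
exchanging the `k`-th points of `T` with those of configurations of `Q` that are far enough away; by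
non-concentration, enough of `Q` qualifies (`exists_swap`). A swap keeps the marginals of `T + Q`
and adds at most `N² φ(r)` per unit of swapped mass to the cost of `Q`. After all swaps `T` is
`r`-separated, so its cost is bounded too. This gives the Lipschitz bound when little mass is moved;
subdividing the segment from `ρ₁` to `ρ₂` removes that restriction. Comparison with one explicit
measure of finite cost gives finiteness. Non-concentration follows from Hölder in `L^p`. For `√ρ` in
`H¹` it follows from the `L²` modulus of continuity: among many disjoint balls near a given one,
some ball is light, and translating `√ρ` to it changes little. No Sobolev embedding is involved. -/

namespace RepulsiveTransport

/-! ### Coupling inside a prescribed set -/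

/-- If every section of `G` has `Q`-mass at least the mass of `T`, then `T` can be coupled
with a part of `Q` inside `G`. -/
theorem exists_partial_coupling {α β : Type*} [MeasurableSpace α] [MeasurableSpace β]
    (T : Measure α) (Q : Measure β) [IsFiniteMeasure T] [IsFiniteMeasure Q] {G : Set (α × β)}
    (hG : MeasurableSet G) {c : ℝ≥0∞} (hc : c ≠ 0)
    (hQ : ∀ t, c ≤ Q (Prod.mk t ⁻¹' G)) (hT : T univ ≤ c) :
    ∃ J : Measure (α × β), IsFiniteMeasure J ∧ J.map Prod.fst = T ∧ J.map Prod.snd ≤ Q ∧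
      ∀ᵐ p ∂J, p ∈ G := by
  set Z : α → ℝ≥0∞ := fun t => Q (Prod.mk t ⁻¹' G) with hZ
  have hZm : Measurable Z := measurable_measure_prodMk_left hG
  have hZ0 : ∀ t, Z t ≠ 0 := fun t h => hc (le_antisymm (h ▸ hQ t) zero_le)
  have hZt : ∀ t, Z t ≠ ⊤ := fun t => measure_ne_top _ _
  -- Normalising each section makes the first marginal exactly `T`. Since `Z ≥ c`, the density is at
  -- most `c⁻¹`, so the second marginal is at most `c⁻¹ T(univ) Q ≤ Q`.
  set w : α × β → ℝ≥0∞ := G.indicator (fun p => (Z p.1)⁻¹) with hw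
  have hwm : Measurable w := (hZm.comp measurable_fst).inv.indicator hG
  have hfst : ((T.prod Q).withDensity w).map Prod.fst = T := by
    ext A hA
    rw [Measure.map_apply measurable_fst hA, withDensity_apply _ (measurable_fst hA),
      ← lintegral_indicator (measurable_fst hA),
      lintegral_prod _ (hwm.indicator (measurable_fst hA)).aemeasurable]
    have : ∀ t, ∫⁻ y, (Prod.fst ⁻¹' A).indicator w (t, y) ∂Q = A.indicator 1 t := by
      intro t
      by_cases ht : t ∈ A
      · have h1 : ∀ y, (Prod.fst ⁻¹' A).indicator w (t, y)
            = (Prod.mk t ⁻¹' G).indicator (fun _ => (Z t)⁻¹) y := by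
          intro y
          simp only [indicator, hw, ht, mem_preimage, if_true]
          congr
        simp_rw [h1]
        rw [lintegral_indicator_const (measurable_prodMk_left hG),
          ENNReal.inv_mul_cancel (hZ0 t) (hZt t)]
        simp [ht]
      · simp [indicator, ht]
    simp_rw [this]
    rw [lintegral_indicator_one hA]
  refine ⟨(T.prod Q).withDensity w, ⟨?_⟩, hfst, ?_, ?_⟩
  · rw [← preimage_univ (f := Prod.fst), ← Measure.map_apply measurable_fst .univ, hfst]
    exact measure_lt_top _ _
  · rw [Measure.le_iff]
    intro B hB
    rw [Measure.map_apply measurable_snd hB, withDensity_apply _ (measurable_snd hB)]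
    calc ∫⁻ p in Prod.snd ⁻¹' B, w p ∂(T.prod Q)
        ≤ ∫⁻ _ in Prod.snd ⁻¹' B, c⁻¹ ∂(T.prod Q) := by
          refine lintegral_mono fun p => ?_
          refine (indicator_le_self' (fun _ _ => zero_le) p).trans ?_
          exact ENNReal.inv_le_inv.2 (hQ p.1)
      _ = c⁻¹ * (T univ * Q B) := by
          rw [setLIntegral_const, ← univ_prod, Measure.prod_prod]
      _ ≤ c⁻¹ * (c * Q B) := by gcongr
      _ ≤ Q B := by
          rw [← mul_assoc]
          exact mul_le_of_le_one_left zero_le (ENNReal.inv_mul_le_one c)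
  · rw [ae_withDensity_iff hwm]
    refine Eventually.of_forall fun p hp => ?_
    by_contra h
    exact hp (indicator_of_notMem h _)

/-! ### Bounds on the cost of separated configurations -/

theorem measurable_pairCost {d : ℕ} {φ : ℝ → ℝ} (hφ : ContinuousOn φ (Ioi 0)) :
    Measurable fun p : Space d × Space d => pairCost φ p.1 p.2 := by
  classical
  have h1 : Measurable ((Ioi (0 : ℝ)).indicator φ) := by
    rw [← piecewise_eq_indicator]
    exact hφ.measurable_piecewise continuousOn_const measurableSet_Ioi
  have h2 : (fun p : Space d × Space d => pairCost φ p.1 p.2) = fun p =>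
      if p.1 = p.2 then ⊤ else ENNReal.ofReal ((Ioi (0 : ℝ)).indicator φ ‖p.1 - p.2‖) := by
    funext p
    unfold pairCost
    split_ifs with h
    · rfl
    · rw [indicator_of_mem]
      exact norm_pos_iff.2 (sub_ne_zero.2 h)
  rw [h2]
  exact Measurable.ite measurableSet_diagonal measurable_const
    (h1.comp (measurable_fst.sub measurable_snd).norm).ennreal_ofReal

theorem measurable_cost {d N : ℕ} {φ : ℝ → ℝ} (hφ : ContinuousOn φ (Ioi 0)) :
    Measurable (cost (d := d) N φ) := by
  refine Finset.measurable_sum _ fun q _ => ?_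
  have h : Measurable fun x : Fin N → Space d => (x q.1, x q.2) :=
    (measurable_pi_apply q.1).prodMk (measurable_pi_apply q.2)
  exact (measurable_pairCost hφ).comp h

theorem pairCost_le {d : ℕ} {φ : ℝ → ℝ} (hφ : IsRepulsivePotential φ) {r : ℝ} (hr : 0 < r)
    {x y : Space d} (h : r ≤ dist x y) : pairCost φ x y ≤ ENNReal.ofReal (φ r) := by
  have hxy : x ≠ y := dist_pos.1 (hr.trans_le h)
  rw [pairCost, if_neg hxy]
  rw [dist_eq_norm] at h
  exact ENNReal.ofReal_le_ofReal (hφ.strictAntiOn.antitoneOn hr (hr.trans_le h) h)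

theorem cost_le_of_separated {d N : ℕ} {φ : ℝ → ℝ} (hφ : IsRepulsivePotential φ) {r : ℝ}
    (hr : 0 < r) {x : Fin N → Space d} (h : ∀ i j, i ≠ j → r ≤ dist (x i) (x j)) :
    cost N φ x ≤ N ^ 2 * ENNReal.ofReal (φ r) := by
  calc cost N φ x ≤ ∑ q : Fin N × Fin N with q.1 < q.2, ENNReal.ofReal (φ r) := by
        refine Finset.sum_le_sum fun q hq => pairCost_le hφ hr (h _ _ ?_)
        exact (Finset.mem_filter.1 hq).2.ne
    _ ≤ ∑ q : Fin N × Fin N, ENNReal.ofReal (φ r) :=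
        Finset.sum_le_sum_of_subset (Finset.filter_subset _ _)
    _ = N ^ 2 * ENNReal.ofReal (φ r) := by simp [sq]

theorem cost_update_le {d N : ℕ} {φ : ℝ → ℝ} (hφ : IsRepulsivePotential φ) {r : ℝ}
    (hr : 0 < r) (y : Fin N → Space d) (k : Fin N) (a : Space d)
    (h : ∀ j, j ≠ k → r ≤ dist (y j) a) :
    cost N φ (Function.update y k a) ≤ cost N φ y + N ^ 2 * ENNReal.ofReal (φ r) := by
  calc cost N φ (Function.update y k a)
      ≤ ∑ q : Fin N × Fin N with q.1 < q.2,
          (pairCost φ (y q.1) (y q.2) + ENNReal.ofReal (φ r)) := by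
        refine Finset.sum_le_sum fun q hq => ?_
        have hq' := (Finset.mem_filter.1 hq).2
        by_cases h1 : q.1 = k
        · have h2 : q.2 ≠ k := fun h2 => hq'.ne (h1.trans h2.symm)
          rw [h1, Function.update_self, Function.update_of_ne h2]
          have h3 : r ≤ dist a (y q.2) := (h _ h2).trans_eq (dist_comm _ _)
          exact (pairCost_le hφ hr h3).trans le_add_self
        · rw [Function.update_of_ne h1]
          by_cases h2 : q.2 = k
          · rw [h2, Function.update_self]
            exact (pairCost_le hφ hr (h _ h1)).trans le_add_self
          · rw [Function.update_of_ne h2]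
            exact le_self_add
    _ ≤ cost N φ y + ∑ q : Fin N × Fin N, ENNReal.ofReal (φ r) := by
        rw [Finset.sum_add_distrib]
        exact add_le_add le_rfl (Finset.sum_le_sum_of_subset (Finset.filter_subset _ _))
    _ = cost N φ y + N ^ 2 * ENNReal.ofReal (φ r) := by simp [sq]

/-! ### Repairing a plan by coordinate swaps -/

/-- Swapping the coordinate `k` between the configurations of `T` and suitable configurations
of `Q` keeps the marginals of `T + Q` and separates the `k`-th points of `T` from the others. -/
theorem exists_swap {d N : ℕ} {φ : ℝ → ℝ} (hφ : IsRepulsivePotential φ) {r : ℝ} (hr : 0 < r)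
    {ε c : ℝ≥0∞} (hc : c ≠ 0) {ρ : Measure (Space d)} (hρ : ∀ x, ρ (Metric.ball x r) ≤ ε)
    (T Q : Measure (Fin N → Space d)) [IsFiniteMeasure T] [IsFiniteMeasure Q]
    (hTQ : ∀ i, (T + Q).map (fun x => x i) = ρ)
    (hT : T univ ≤ c) (hQ : c + 2 * N * ε ≤ Q univ) {s : Finset (Fin N)} {k : Fin N}
    (hk : k ∉ s) (hs : ∀ᵐ t ∂T, ∀ i ∈ s, ∀ j ∈ s, i ≠ j → r ≤ dist (t i) (t j)) :
    ∃ T' Q' : Measure (Fin N → Space d), IsFiniteMeasure T' ∧ IsFiniteMeasure Q' ∧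
      T' univ = T univ ∧ Q' univ = Q univ ∧ (∀ i, (T' + Q').map (fun x => x i) = ρ) ∧
      (∀ᵐ t ∂T', ∀ i ∈ insert k s, ∀ j ∈ insert k s, i ≠ j → r ≤ dist (t i) (t j)) ∧
      ∫⁻ x, cost N φ x ∂Q' ≤
        ∫⁻ x, cost N φ x ∂Q + N ^ 2 * ENNReal.ofReal (φ r) * T univ := by
  have hQρ : ∀ (i : Fin N) (x : Space d), Q {y | dist (y i) x < r} ≤ ε := by
    intro i x
    refine le_trans ?_ (hρ x)
    rw [← hTQ i, Measure.map_apply (measurable_pi_apply i) Metric.isOpen_ball.measurableSet]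
    exact le_add_self
  -- The first inequality controls the cost of the configuration of `Q` after it receives the `k`-th
  -- point of `T`; the second separates the point that `T` receives in exchange.
  set G : Set ((Fin N → Space d) × (Fin N → Space d)) :=
    {p | ∀ j, j ≠ k → r ≤ dist (p.2 j) (p.1 k) ∧ r ≤ dist (p.2 k) (p.1 j)} with hG
  have hm1 : ∀ i, Measurable fun p : (Fin N → Space d) × (Fin N → Space d) => p.1 i :=
    fun i => (measurable_pi_apply i).comp measurable_fst
  have hm2 : ∀ i, Measurable fun p : (Fin N → Space d) × (Fin N → Space d) => p.2 i :=
    fun i => (measurable_pi_apply i).comp measurable_snd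
  have hGm : MeasurableSet G := by
    have : G = ⋂ j, ⋂ (_ : j ≠ k), ({p | r ≤ dist (p.2 j) (p.1 k)} ∩
        {p | r ≤ dist (p.2 k) (p.1 j)}) := by
      ext p
      simp [hG]
    rw [this]
    refine MeasurableSet.iInter fun j => MeasurableSet.iInter fun _ => ?_
    exact (measurableSet_le measurable_const ((hm2 j).dist (hm1 k))).inter
      (measurableSet_le measurable_const ((hm2 k).dist (hm1 j)))
  have hZ : ∀ t, c ≤ Q (Prod.mk t ⁻¹' G) := by
    intro t
    have h1 : (Prod.mk t ⁻¹' G)ᶜ ⊆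
        ⋃ j ∈ (Finset.univ : Finset (Fin N)),
          ({y | dist (y j) (t k) < r} ∪ {y | dist (y k) (t j) < r}) := by
      intro y hy
      simp only [hG, mem_compl_iff, mem_preimage, mem_ofPred_eq, not_forall, not_and_or,
        not_le] at hy
      obtain ⟨j, -, hj⟩ := hy
      simp only [mem_iUnion]
      exact ⟨j, Finset.mem_univ _, hj⟩
    -- For each `j` there are two ways to fail, each confining one coordinate of `Q` to a ball of
    -- radius `r`.
    have h2 : Q (Prod.mk t ⁻¹' G)ᶜ ≤ 2 * N * ε := by
      refine (measure_mono h1).trans ((measure_biUnion_finset_le _ _).trans ?_)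
      calc _ ≤ ∑ j : Fin N, (ε + ε) := Finset.sum_le_sum fun j _ =>
            (measure_union_le _ _).trans (add_le_add (hQρ _ _) (hQρ _ _))
        _ = 2 * N * ε := by
            simp
            ring
    have h3 : Q univ ≤ Q (Prod.mk t ⁻¹' G) + Q (Prod.mk t ⁻¹' G)ᶜ := by
      rw [← union_compl_self (Prod.mk t ⁻¹' G)]
      exact measure_union_le _ _
    have h4 : c + Q (Prod.mk t ⁻¹' G)ᶜ ≤ Q (Prod.mk t ⁻¹' G) + Q (Prod.mk t ⁻¹' G)ᶜ :=
      ((add_le_add le_rfl h2).trans hQ).trans h3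
    exact (ENNReal.add_le_add_iff_right (measure_ne_top _ _)).1 h4
  obtain ⟨J, hJ, hJ1, hJ2, hJG⟩ := exists_partial_coupling T Q hGm hc hZ hT
  have hJ2fin : IsFiniteMeasure (J.map Prod.snd) := inferInstance
  obtain ⟨R, hRfin, hR⟩ : ∃ R : Measure (Fin N → Space d), IsFiniteMeasure R ∧
      Q = R + J.map Prod.snd :=
    ⟨Q - J.map Prod.snd, inferInstance, (Measure.sub_add_cancel_of_le hJ2).symm⟩
  have hup1 : Measurable fun p : (Fin N → Space d) × (Fin N → Space d) =>
      Function.update p.1 k (p.2 k) := by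
    refine measurable_pi_iff.2 fun i => ?_
    by_cases h : i = k
    · subst h; simpa using hm2 i
    · simpa [h] using hm1 i
  have hup2 : Measurable fun p : (Fin N → Space d) × (Fin N → Space d) =>
      Function.update p.2 k (p.1 k) := by
    refine measurable_pi_iff.2 fun i => ?_
    by_cases h : i = k
    · subst h; simpa using hm1 i
    · simpa [h] using hm2 i
  have hJu : J univ = T univ := by
    rw [← hJ1, Measure.map_apply measurable_fst .univ, preimage_univ]
  -- `R` is the part of `Q` left without a partner. Along `J` the two `k`-th marginals are exchanged
  -- and the others stay put, so the marginals of the sum do not change.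
  refine ⟨J.map fun p => Function.update p.1 k (p.2 k),
    R + J.map fun p => Function.update p.2 k (p.1 k), inferInstance, inferInstance, ?_, ?_, ?_,
    ?_, ?_⟩
  · rw [Measure.map_apply hup1 .univ, preimage_univ, hJu]
  · rw [hR, Measure.add_apply, Measure.add_apply, Measure.map_apply hup2 .univ,
      Measure.map_apply measurable_snd .univ, preimage_univ, preimage_univ]
  · intro i
    have hi := measurable_pi_apply (X := fun _ : Fin N => Space d) i
    rw [← hTQ i, hR, ← hJ1]
    simp only [Measure.map_add _ _ hi]
    rw [Measure.map_map hi hup1, Measure.map_map hi hup2, Measure.map_map hi measurable_fst,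
      Measure.map_map hi measurable_snd]
    by_cases h : i = k
    · subst h
      simp only [Function.comp_def, Function.update_self]
      abel
    · simp only [Function.comp_def, Function.update_of_ne h]
  · have hJs : ∀ᵐ p ∂J, ∀ i ∈ s, ∀ j ∈ s, i ≠ j → r ≤ dist (p.1 i) (p.1 j) :=
      ae_of_ae_map measurable_fst.aemeasurable (hJ1 ▸ hs)
    rw [ae_map_iff hup1.aemeasurable]
    · filter_upwards [hJG, hJs] with p hp hps i hi j hj hij
      by_cases h1 : i = k
      · have h2 : j ≠ k := fun h2 => hij (h1.trans h2.symm)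
        rw [h1, Function.update_self, Function.update_of_ne h2]
        exact (hp j h2).2
      · rw [Function.update_of_ne h1]
        by_cases h2 : j = k
        · rw [h2, Function.update_self, dist_comm]
          exact (hp i h1).2
        · rw [Function.update_of_ne h2]
          exact hps i (Finset.mem_of_mem_insert_of_ne hi h1) j
            (Finset.mem_of_mem_insert_of_ne hj h2) hij
    · have : {t : Fin N → Space d |
          ∀ i ∈ insert k s, ∀ j ∈ insert k s, i ≠ j → r ≤ dist (t i) (t j)} =
          ⋂ i ∈ insert k s, ⋂ j ∈ insert k s, ⋂ (_ : i ≠ j), {t | r ≤ dist (t i) (t j)} := by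
        ext t
        simp only [mem_iInter, mem_ofPred_eq]
      rw [this]
      refine Finset.measurableSet_biInter _ fun i _ => Finset.measurableSet_biInter _ fun j _ =>
        MeasurableSet.iInter fun _ => measurableSet_le measurable_const ?_
      exact (measurable_pi_apply i).dist (measurable_pi_apply j)
  · have hcm := measurable_cost (d := d) (N := N) hφ.continuousOn
    rw [hR, lintegral_add_measure, lintegral_add_measure, lintegral_map hcm hup2,
      lintegral_map hcm measurable_snd, add_assoc]
    gcongr
    calc ∫⁻ p, cost N φ (Function.update p.2 k (p.1 k)) ∂J
        ≤ ∫⁻ p, (cost N φ p.2 + N ^ 2 * ENNReal.ofReal (φ r)) ∂J := by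
          refine lintegral_mono_ae ?_
          filter_upwards [hJG] with p hp
          exact cost_update_le hφ hr _ _ _ fun j hj => (hp j hj).1
      _ = _ := by
          rw [lintegral_add_right _ measurable_const, lintegral_const, hJu]

/-- The swaps can be iterated because their hypotheses involve only total masses and the marginals
of the sum, all of which a swap preserves. The cost of `T` is not tracked: it may be infinite until
every coordinate has been treated. -/
theorem exists_separated_swap {d N : ℕ} {φ : ℝ → ℝ} (hφ : IsRepulsivePotential φ) {r : ℝ}
    (hr : 0 < r) {ε c : ℝ≥0∞} (hc : c ≠ 0) {ρ : Measure (Space d)}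
    (hρ : ∀ x, ρ (Metric.ball x r) ≤ ε)
    (T Q : Measure (Fin N → Space d)) [IsFiniteMeasure T] [IsFiniteMeasure Q]
    (hTQ : ∀ i, (T + Q).map (fun x => x i) = ρ)
    (hT : T univ ≤ c) (hQ : c + 2 * N * ε ≤ Q univ) (s : Finset (Fin N)) :
    ∃ T' Q' : Measure (Fin N → Space d), IsFiniteMeasure T' ∧ IsFiniteMeasure Q' ∧
      T' univ = T univ ∧ Q' univ = Q univ ∧ (∀ i, (T' + Q').map (fun x => x i) = ρ) ∧
      (∀ᵐ t ∂T', ∀ i ∈ s, ∀ j ∈ s, i ≠ j → r ≤ dist (t i) (t j)) ∧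
      ∫⁻ x, cost N φ x ∂Q' ≤
        ∫⁻ x, cost N φ x ∂Q + s.card * (N ^ 2 * ENNReal.ofReal (φ r) * T univ) := by
  classical
  induction s using Finset.induction_on with
  | empty => exact ⟨T, Q, inferInstance, inferInstance, rfl, rfl, hTQ, by simp, by simp⟩
  | insert k s hk ih =>
    obtain ⟨T₁, Q₁, _, _, hT₁, hQ₁, hTQ₁, hs₁, hc₁⟩ := ih
    obtain ⟨T₂, Q₂, hf, hf', hT₂, hQ₂, hTQ₂, hs₂, hc₂⟩ := exists_swap hφ hr hc hρ T₁ Q₁ hTQ₁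
      (hT₁ ▸ hT) (hQ₁ ▸ hQ) hk hs₁
    refine ⟨T₂, Q₂, hf, hf', hT₂.trans hT₁, hQ₂.trans hQ₁, hTQ₂, hs₂, ?_⟩
    rw [Finset.card_insert_of_notMem hk]
    calc _ ≤ _ := hc₂
      _ ≤ _ := add_le_add hc₁ le_rfl
      _ = _ := by
        rw [hT₁]
        push_cast
        ring

/-! ### Completing a partial plan -/

/-- A sub-probability `Q` whose marginals are all below `ρ` with missing mass `m` extends to
a plan of `ρ`, at a cost proportional to `m`. -/
theorem exists_plan_of_partial {d N : ℕ} {φ : ℝ → ℝ} (hφ : IsRepulsivePotential φ) {r : ℝ}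
    (hr : 0 < r) {ε c : ℝ≥0∞} (hc : c ≠ 0) (hN : N ≠ 0) {ρ : Measure (Space d)}
    [IsProbabilityMeasure ρ] (hρ : ∀ x, ρ (Metric.ball x r) ≤ ε)
    (Q : Measure (Fin N → Space d)) [IsFiniteMeasure Q]
    (hQρ : ∀ i, Q.map (fun x => x i) ≤ ρ) {m : ℝ≥0∞} (hm : m ≤ c) (hQm : m + Q univ = 1)
    (hQ : c + 2 * N * ε ≤ Q univ) :
    ∃ P ∈ plans N ρ, ∫⁻ x, cost N φ x ∂P ≤
        ∫⁻ x, cost N φ x ∂Q + 2 * N ^ 3 * ENNReal.ofReal (φ r) * m := by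
  have hmt : m ≠ ⊤ := fun h => by simp [h] at hQm
  have hpi := fun i : Fin N => measurable_pi_apply (X := fun _ : Fin N => Space d) i
  obtain ⟨T, hTfin, hTu, hTQ⟩ : ∃ T : Measure (Fin N → Space d), IsFiniteMeasure T ∧
      T univ = m ∧ ∀ i, (T + Q).map (fun x => x i) = ρ := by
    set σ : Fin N → Measure (Space d) := fun i => ρ - Q.map (fun x => x i) with hσ
    have hσQ : ∀ i, σ i + Q.map (fun x => x i) = ρ := fun i =>
      Measure.sub_add_cancel_of_le (hQρ i)
    have hσu : ∀ i, σ i univ = m := by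
      intro i
      have h := congrArg (fun ν => ν univ) (hσQ i)
      simp only [Measure.add_apply, measure_univ] at h
      rw [Measure.map_apply (hpi i) .univ, preimage_univ, ← hQm] at h
      exact (ENNReal.add_left_inj (measure_ne_top _ _)).1 h
    by_cases hm0 : m = 0
    · refine ⟨0, inferInstance, by simp [hm0], fun i => ?_⟩
      have : σ i = 0 := Measure.measure_univ_eq_zero.1 ((hσu i).trans hm0)
      rw [zero_add, ← hσQ i, this, zero_add]
    -- All missing marginals have the same mass `m`, so they can be normalised and multiplied; `m`
    -- times the product has marginals `σ i`.
    · set τ : Fin N → Measure (Space d) := fun i => m⁻¹ • σ i with hτ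
      have hτp : ∀ i, IsProbabilityMeasure (τ i) := fun i => ⟨by
        rw [hτ, Measure.smul_apply, hσu, smul_eq_mul, ENNReal.inv_mul_cancel hm0 hmt]⟩
      refine ⟨m • Measure.pi τ, ⟨?_⟩, by simp, fun i => ?_⟩
      · simpa using hmt.lt_top
      · rw [Measure.map_add _ _ (hpi i), Measure.map_smul]
        have h1 : (Measure.pi τ).map (fun x => x i) = τ i :=
          (measurePreserving_eval τ i).map_eq
        rw [h1, hτ, smul_smul, ENNReal.mul_inv_cancel hm0 hmt, one_smul, hσQ]
  obtain ⟨T', Q', _, _, hT', hQ', hTQ', hs, hcost⟩ := exists_separated_swap hφ hr hc hρ T Q hTQ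
    (hTu ▸ hm) hQ Finset.univ
  refine ⟨T' + Q', ⟨⟨?_⟩, hTQ'⟩, ?_⟩
  · rw [Measure.add_apply, hT', hQ', hTu, hQm]
  · have h1 : ∫⁻ x, cost N φ x ∂T' ≤ N ^ 2 * ENNReal.ofReal (φ r) * m := by
      calc ∫⁻ x, cost N φ x ∂T' ≤ ∫⁻ _, N ^ 2 * ENNReal.ofReal (φ r) ∂T' := by
            refine lintegral_mono_ae ?_
            filter_upwards [hs] with t ht
            exact cost_le_of_separated hφ hr fun i j =>
              ht i (Finset.mem_univ _) j (Finset.mem_univ _)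
        _ = _ := by rw [lintegral_const, hT', hTu]
    have h2 : (1 : ℝ≥0∞) ≤ N := by exact_mod_cast Nat.one_le_iff_ne_zero.2 hN
    rw [lintegral_add_measure]
    rw [Finset.card_univ, Fintype.card_fin, hTu] at hcost
    calc _ ≤ 1 * (N ^ 2 * ENNReal.ofReal (φ r) * m) + (∫⁻ x, cost N φ x ∂Q +
          N * (N ^ 2 * ENNReal.ofReal (φ r) * m)) := add_le_add (h1.trans_eq (one_mul _).symm) hcost
      _ ≤ N * (N ^ 2 * ENNReal.ofReal (φ r) * m) + (∫⁻ x, cost N φ x ∂Q +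
          N * (N ^ 2 * ENNReal.ofReal (φ r) * m)) := by gcongr
      _ = _ := by ring

/-! ### Thinning a plan and comparing two costs -/

theorem one_le_prod_add_sum_one_sub {ι : Type*} (s : Finset ι) (g : ι → ℝ≥0∞)
    (hg : ∀ i, g i ≤ 1) : 1 ≤ ∏ i ∈ s, g i + ∑ i ∈ s, (1 - g i) := by
  classical
  induction s using Finset.induction_on with
  | empty => simp
  | insert k s hk ih =>
    rw [Finset.prod_insert hk, Finset.sum_insert hk]
    have hp : ∏ i ∈ s, g i ≤ 1 := Finset.prod_le_one' fun i _ => hg i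
    calc (1 : ℝ≥0∞) ≤ ∏ i ∈ s, g i + ∑ i ∈ s, (1 - g i) := ih
      _ = (g k + (1 - g k)) * ∏ i ∈ s, g i + ∑ i ∈ s, (1 - g i) := by
        rw [add_tsub_cancel_of_le (hg k), one_mul]
      _ ≤ (g k * ∏ i ∈ s, g i + (1 - g k) * 1) + ∑ i ∈ s, (1 - g i) := by
        rw [add_mul]
        gcongr
      _ = _ := by rw [mul_one, add_assoc]

/-- A plan of `ρ₁` contains a part with marginals below `μ ≤ ρ₁` missing at most `N` times the
mass which `μ` misses. -/
theorem exists_partial_plan {d N : ℕ} {ρ₁ μ : Measure (Space d)} [IsProbabilityMeasure ρ₁]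
    (hμ : μ ≤ ρ₁) {δ : ℝ≥0∞} (hδ : 1 ≤ μ univ + δ) {P : Measure (Fin N → Space d)}
    (hP : P ∈ plans N ρ₁) :
    ∃ Q ≤ P, (∀ i, Q.map (fun x => x i) ≤ μ) ∧ 1 ≤ Q univ + N * δ := by
  obtain ⟨hPp, hPm⟩ := hP
  have hμf : IsFiniteMeasure μ := isFiniteMeasure_of_le ρ₁ hμ
  have hpi := fun i : Fin N => measurable_pi_apply (X := fun _ : Fin N => Space d) i
  obtain ⟨g, hgm, hg1, hgμ⟩ : ∃ g : Space d → ℝ≥0∞, Measurable g ∧ (∀ x, g x ≤ 1) ∧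
      ρ₁.withDensity g = μ := by
    -- Truncating at `1` changes the density only on a null set and makes the bound hold everywhere.
    refine ⟨fun x => min (μ.rnDeriv ρ₁ x) 1, (Measure.measurable_rnDeriv _ _).min
      measurable_const, fun x => min_le_right _ _, ?_⟩
    have := Measure.haveLebesgueDecomposition_of_sigmaFinite μ ρ₁
    refine Eq.trans (withDensity_congr_ae ?_)
      (Measure.withDensity_rnDeriv_eq μ ρ₁ (Measure.absolutelyContinuous_of_le hμ))
    filter_upwards [Measure.rnDeriv_le_one_of_le hμ] with x hx
    exact min_eq_left hx
  have hgi : ∀ i : Fin N, Measurable fun x : Fin N → Space d => g (x i) :=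
    fun i => hgm.comp (hpi i)
  have hprod : Measurable fun x : Fin N → Space d => ∏ i, g (x i) :=
    Finset.measurable_fun_prod _ fun i _ => hgi i
  refine ⟨P.withDensity fun x => ∏ i, g (x i), ?_, fun i => ?_, ?_⟩
  · calc P.withDensity (fun x => ∏ i, g (x i)) ≤ P.withDensity 1 :=
          withDensity_mono (Eventually.of_forall fun x => Finset.prod_le_one' fun i _ => hg1 _)
      _ = P := withDensity_one
  · rw [Measure.le_iff]
    intro A hA
    rw [Measure.map_apply (hpi i) hA, withDensity_apply _ (hpi i hA), ← hgμ,
      withDensity_apply _ hA, ← hPm i, setLIntegral_map hA hgm (hpi i)]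
    refine lintegral_mono fun x => ?_
    rw [← Finset.mul_prod_erase _ _ (Finset.mem_univ i)]
    exact mul_le_of_le_one_right zero_le (Finset.prod_le_one' fun i _ => hg1 _)
  · have h1 : ∀ i : Fin N, ∫⁻ x, (1 - g (x i)) ∂P ≤ δ := by
      intro i
      have h2 : ∫⁻ x, (1 - g (x i)) ∂P = ∫⁻ y, (1 - g y) ∂ρ₁ := by
        rw [← hPm i, lintegral_map (by fun_prop) (hpi i)]
      have h3 : ∫⁻ y, g y ∂ρ₁ = μ univ := by
        rw [← hgμ, withDensity_apply _ .univ, setLIntegral_univ]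
      rw [h2, lintegral_sub hgm (h3 ▸ measure_ne_top _ _) (Eventually.of_forall hg1), h3,
        lintegral_one, measure_univ]
      exact tsub_le_iff_left.2 hδ
    rw [withDensity_apply _ .univ, setLIntegral_univ]
    calc (1 : ℝ≥0∞) = ∫⁻ _, 1 ∂P := by simp
      _ ≤ ∫⁻ x, (∏ i, g (x i) + ∑ i, (1 - g (x i))) ∂P :=
        lintegral_mono fun x => one_le_prod_add_sum_one_sub _ _ fun i => hg1 _
      _ = ∫⁻ x, ∏ i, g (x i) ∂P + ∑ i, ∫⁻ x, (1 - g (x i)) ∂P := by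
        rw [lintegral_add_left hprod, lintegral_finsetSum _ fun i _ => by fun_prop]
      _ ≤ ∫⁻ x, ∏ i, g (x i) ∂P + ∑ _i : Fin N, δ := by
        gcongr
        exact h1 _
      _ = _ := by simp

theorem transportCost_le_of_common_part {d N : ℕ} {φ : ℝ → ℝ} (hφ : IsRepulsivePotential φ)
    (hN : N ≠ 0) {r : ℝ} (hr : 0 < r) {ρ₁ ρ₂ μ : Measure (Space d)} [IsProbabilityMeasure ρ₁]
    [IsProbabilityMeasure ρ₂] (hρ : ∀ x, ρ₂ (Metric.ball x r) ≤ (8 * N : ℝ≥0∞)⁻¹)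
    (hμ₁ : μ ≤ ρ₁) (hμ₂ : μ ≤ ρ₂) {δ : ℝ≥0∞} (hδ : 1 ≤ μ univ + δ) (hδN : N * δ ≤ 4⁻¹) :
    transportCost N φ ρ₂ ≤ transportCost N φ ρ₁ + 2 * N ^ 4 * ENNReal.ofReal (φ r) * δ := by
  have hN0 : (N : ℝ≥0∞) ≠ 0 := by exact_mod_cast hN
  rw [transportCost, transportCost, ENNReal.iInf_add]
  refine le_iInf fun P => ?_
  by_cases hP : P ∈ plans N ρ₁
  swap
  · simp [hP]
  rw [ENNReal.iInf_add]
  refine le_iInf fun _ => ?_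
  obtain ⟨Q, hQP, hQμ, hQu⟩ := exists_partial_plan hμ₁ hδ hP
  have hPp : IsProbabilityMeasure P := hP.1
  have hQf : IsFiniteMeasure Q := isFiniteMeasure_of_le P hQP
  have hQ1 : Q univ ≤ 1 := (hQP univ).trans_eq measure_univ
  have hm : 1 - Q univ ≤ N * δ := tsub_le_iff_left.2 hQu
  -- The budget: `1/4` for the mass being repaired, `2N/(8N) = 1/4` for forbidden partners, and at
  -- most `1/4` lost in the thinning.
  have h34 : (4⁻¹ : ℝ≥0∞) + 2 * N * (8 * N : ℝ≥0∞)⁻¹ ≤ Q univ := by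
    have h1 : (2 * N * (8 * N : ℝ≥0∞)⁻¹ : ℝ≥0∞) = 4⁻¹ := by
      rw [ENNReal.mul_inv (by simp) (by simp), mul_mul_mul_comm,
        ENNReal.mul_inv_cancel hN0 (ENNReal.natCast_ne_top N), mul_one,
        show (8 : ℝ≥0∞) = 2 * 4 by norm_num, ENNReal.mul_inv (by simp) (by simp), ← mul_assoc,
        ENNReal.mul_inv_cancel (by simp) (by simp), one_mul]
    have h2 : (4⁻¹ + 4⁻¹ + 4⁻¹ : ℝ≥0∞) ≤ 1 := by
      rw [← ENNReal.toReal_le_toReal (by finiteness) (by simp),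
        ENNReal.toReal_add (by finiteness) (by finiteness),
        ENNReal.toReal_add (by finiteness) (by finiteness)]
      norm_num
    rw [h1]
    refine (ENNReal.add_le_add_iff_right (a := 4⁻¹) (by simp)).1 ?_
    exact h2.trans (hQu.trans (add_le_add le_rfl hδN))
  obtain ⟨P', hP', hc⟩ := exists_plan_of_partial hφ hr (c := 4⁻¹) (by simp) hN hρ Q
    (fun i => (hQμ i).trans hμ₂) (hm.trans hδN) (tsub_add_cancel_of_le hQ1) h34
  refine (iInf₂_le P' hP').trans (hc.trans ?_)
  calc _ ≤ ∫⁻ x, cost N φ x ∂P + 2 * N ^ 3 * ENNReal.ofReal (φ r) * (N * δ) := by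
        gcongr
    _ = _ := by ring

/-- The smallness condition is removed by moving from `μ + σ₁` to `μ + σ₂` in `4N` equal steps. Each
step moves mass at most `1/(4N)`, and the step costs add up to a bound linear in the mass of `σ₁`.
-/
theorem transportCost_le_add {d N : ℕ} {φ : ℝ → ℝ} (hφ : IsRepulsivePotential φ)
    (hN : N ≠ 0) {r : ℝ} (hr : 0 < r) {μ σ₁ σ₂ : Measure (Space d)}
    [h₁ : IsProbabilityMeasure (μ + σ₁)] [h₂ : IsProbabilityMeasure (μ + σ₂)]
    (hρ₁ : ∀ x, (μ + σ₁) (Metric.ball x r) ≤ (8 * N : ℝ≥0∞)⁻¹)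
    (hρ₂ : ∀ x, (μ + σ₂) (Metric.ball x r) ≤ (8 * N : ℝ≥0∞)⁻¹) :
    transportCost N φ (μ + σ₂) ≤
      transportCost N φ (μ + σ₁) + 2 * N ^ 4 * ENNReal.ofReal (φ r) * σ₁ univ := by
  set n : ℕ := 4 * N with hn
  have hn0 : (n : ℝ≥0∞) ≠ 0 := by simp [hn, hN]
  have hnt : (n : ℝ≥0∞) ≠ ⊤ := ENNReal.natCast_ne_top n
  obtain ⟨s₁, hs₁⟩ : ∃ s : Measure (Space d), n • s = σ₁ := ⟨(n : ℝ≥0∞)⁻¹ • σ₁, by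
    rw [← Nat.cast_smul_eq_nsmul ℝ≥0∞, smul_smul, ENNReal.mul_inv_cancel hn0 hnt, one_smul]⟩
  obtain ⟨s₂, hs₂⟩ : ∃ s : Measure (Space d), n • s = σ₂ := ⟨(n : ℝ≥0∞)⁻¹ • σ₂, by
    rw [← Nat.cast_smul_eq_nsmul ℝ≥0∞, smul_smul, ENNReal.mul_inv_cancel hn0 hnt, one_smul]⟩
  set τ : ℕ → Measure (Space d) := fun k => μ + (n - k) • s₁ + k • s₂ with hτ
  -- Non-concentration survives along the segment, since `n τ_k = (n - k)(μ + σ₁) + k(μ + σ₂)`.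
  have hmass : ∀ k ≤ n, ∀ A b, (μ + σ₁) A ≤ b → (μ + σ₂) A ≤ b → τ k A ≤ b := by
    intro k hk A b hb₁ hb₂
    refine (ENNReal.mul_le_mul_iff_right hn0 hnt).1 ?_
    have hkn : (n : ℝ≥0∞) = (n - k : ℕ) + k := by rw [← Nat.cast_add, Nat.sub_add_cancel hk]
    simp only [hτ, ← hs₁, ← hs₂, Measure.add_apply, Measure.smul_apply, nsmul_eq_mul]
      at hb₁ hb₂ ⊢
    calc _ = (n : ℝ≥0∞) * μ A + (n - k : ℕ) * (n * s₁ A) + k * (n * s₂ A) := by ring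
      _ = ((n - k : ℕ) + k) * μ A + (n - k : ℕ) * (n * s₁ A) + k * (n * s₂ A) := by rw [← hkn]
      _ = (n - k : ℕ) * (μ A + n * s₁ A) + k * (μ A + n * s₂ A) := by ring
      _ ≤ (n - k : ℕ) * b + k * b := by gcongr
      _ = n * b := by rw [← add_mul, ← hkn]
  have hmass' : ∀ k ≤ n, τ k univ = 1 := by
    intro k hk
    have e : s₁ univ = s₂ univ := by
      have e₁ := h₁.measure_univ.trans h₂.measure_univ.symm
      have hμt : μ univ ≠ ⊤ := ne_top_of_le_ne_top ENNReal.one_ne_top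
        (h₁.measure_univ ▸ Measure.le_iff'.1 (Measure.le_add_right le_rfl) univ)
      rw [Measure.add_apply, Measure.add_apply, ENNReal.add_right_inj hμt, ← hs₁, ← hs₂] at e₁
      simp only [Measure.smul_apply, nsmul_eq_mul] at e₁
      exact (ENNReal.mul_right_inj hn0 hnt).1 e₁
    rw [← h₁.measure_univ, ← hs₁]
    simp only [hτ, Measure.add_apply, Measure.smul_apply, nsmul_eq_mul]
    rw [← e, add_assoc, ← add_mul, ← Nat.cast_add, Nat.sub_add_cancel hk]
  have key : ∀ k ≤ n, transportCost N φ (τ k) ≤ transportCost N φ (μ + σ₁) +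
      k * (2 * N ^ 4 * ENNReal.ofReal (φ r) * s₁ univ) := by
    intro k
    induction k with
    | zero => simp [hτ, hs₁]
    | succ k ih =>
      intro hk
      have hk' : k ≤ n := (Nat.le_succ k).trans hk
      have hp : IsProbabilityMeasure (τ k) := ⟨hmass' k hk'⟩
      have hp' : IsProbabilityMeasure (τ (k + 1)) := ⟨hmass' _ hk⟩
      set ν : Measure (Space d) := μ + (n - (k + 1)) • s₁ + k • s₂ with hν
      have e₁ : τ k = ν + s₁ := by
        simp only [hτ, hν]
        rw [show n - k = n - (k + 1) + 1 by omega, succ_nsmul]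
        abel
      have e₂ : τ (k + 1) = ν + s₂ := by
        simp only [hτ, hν]
        rw [succ_nsmul, ← add_assoc]
      have hstep := transportCost_le_of_common_part (ρ₁ := τ k) (ρ₂ := τ (k + 1)) hφ hN hr
        (fun x => hmass _ hk _ _ (hρ₁ x) (hρ₂ x)) (μ := ν) (δ := s₁ univ)
        (e₁ ▸ Measure.le_add_right le_rfl) (e₂ ▸ Measure.le_add_right le_rfl) (by
          rw [← Measure.add_apply, ← e₁, hmass' k hk']) (by
          have h5 : σ₁ univ ≤ 1 := by
            rw [← h₁.measure_univ, Measure.add_apply]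
            exact le_add_self
          rw [← hs₁, Measure.smul_apply, nsmul_eq_mul, hn] at h5
          push_cast at h5
          rw [mul_assoc] at h5
          rw [← one_div, ENNReal.le_div_iff_mul_le (by simp) (by simp), mul_comm]
          exact h5)
      refine hstep.trans ((add_le_add (ih hk') le_rfl).trans_eq ?_)
      push_cast
      ring
  have hfin := key n le_rfl
  have e : τ n = μ + σ₂ := by simp [hτ, hs₂]
  rw [e] at hfin
  refine hfin.trans_eq ?_
  rw [← hs₁, Measure.smul_apply, nsmul_eq_mul]
  ring

/-! ### Finiteness of the cost -/

theorem two_mul_le_dist_single {d : ℕ} (i : Fin d) {r : ℝ} (hr : 0 < r) {k l : ℕ} (hkl : k ≠ l) :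
    2 * r ≤ dist (PiLp.single 2 i (2 * r * (k : ℝ)) : Space d)
      (PiLp.single 2 i (2 * r * (l : ℝ))) := by
  rw [PiLp.dist_single_same, Real.dist_eq, ← mul_sub, abs_mul,
    abs_of_pos (by positivity : 0 < 2 * r)]
  refine le_mul_of_one_le_right (by positivity) ?_
  have : (k : ℤ) - l ≠ 0 := by
    rw [sub_ne_zero]
    exact_mod_cast hkl
  exact_mod_cast Int.one_le_abs this

theorem exists_spread_measure {d N : ℕ} {φ : ℝ → ℝ} (hφ : IsRepulsivePotential φ) (hd : 0 < d)
    (hN : N ≠ 0) {r : ℝ} (hr : 0 < r) :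
    ∃ ρ : Measure (Space d), IsProbabilityMeasure ρ ∧
      (∀ x, ρ (Metric.ball x r) ≤ (8 * N : ℝ≥0∞)⁻¹) ∧ transportCost N φ ρ ≠ ⊤ := by
  have : NeZero (8 * N) := ⟨by simp [hN]⟩
  have hM0 : (8 * N : ℝ≥0∞) ≠ 0 := by simp [hN]
  have hMt : (8 * N : ℝ≥0∞) ≠ ⊤ := by finiteness
  -- With spacing `2r`, an open ball of radius `r` holds at most one of the `8N` atoms.
  set a : Fin (8 * N) → Space d := fun k =>
    PiLp.single 2 ⟨0, hd⟩ (2 * r * ((k : ℕ) : ℝ)) with ha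
  have hdist : ∀ k l, k ≠ l → 2 * r ≤ dist (a k) (a l) := fun k l hkl =>
    two_mul_le_dist_single _ hr (Fin.val_ne_of_ne hkl)
  set u : Measure (Fin (8 * N)) := (8 * N : ℝ≥0∞)⁻¹ • Measure.count with hu
  have hup : IsProbabilityMeasure u := ⟨by
    rw [hu, Measure.smul_apply, Measure.count_univ]
    simpa using ENNReal.inv_mul_cancel hM0 hMt⟩
  have hinv : ∀ j, u.map (fun k => k + j) = u := by
    intro j
    rw [hu, Measure.map_smul, map_add_right_eq_self]
  set ι : Fin N → Fin (8 * N) := Fin.castLE (by omega) with hι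
  set P : Measure (Fin N → Space d) := u.map fun k i => a (k + ι i) with hP
  -- no
  have hPp : IsProbabilityMeasure P := Measure.isProbabilityMeasure_map (by fun_prop)
  refine ⟨u.map a, Measure.isProbabilityMeasure_map (by fun_prop), fun x => ?_, ?_⟩
  · have hsub : (a ⁻¹' Metric.ball x r).Subsingleton := by
      intro k hk l hl
      by_contra hkl
      have h1 : dist (a k) x < r := hk
      have h2 : dist (a l) x < r := hl
      have h3 := dist_triangle_right (a k) (a l) x
      linarith [hdist k l hkl]
    rw [Measure.map_apply (by fun_prop) Metric.isOpen_ball.measurableSet, hu,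
      Measure.smul_apply, smul_eq_mul, Measure.count_apply (MeasurableSet.of_discrete)]
    refine mul_le_of_le_one_right zero_le ?_
    exact_mod_cast encard_le_one_iff_subsingleton.2 hsub
  · refine ne_top_of_le_ne_top ?_ (iInf₂_le P ⟨hPp, fun i => ?_⟩)
    · have hb : ∫⁻ x, cost N φ x ∂P ≤ N ^ 2 * ENNReal.ofReal (φ r) := by
        rw [hP, lintegral_map (measurable_cost hφ.continuousOn) (by fun_prop)]
        calc _ ≤ ∫⁻ _, N ^ 2 * ENNReal.ofReal (φ r) ∂u := by
              refine lintegral_mono fun k => cost_le_of_separated hφ hr fun i j hij => ?_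
              refine le_trans (by linarith) (hdist _ _ fun h => hij ?_)
              exact Fin.castLE_injective _ (add_left_cancel h)
          _ = _ := by simp
      exact ne_top_of_le_ne_top (by finiteness) hb
    · rw [hP, Measure.map_map (measurable_pi_apply i) (by fun_prop)]
      conv_rhs => rw [← hinv (ι i), Measure.map_map (by fun_prop) (by fun_prop)]
      rfl

theorem transportCost_ne_top {d N : ℕ} {φ : ℝ → ℝ} (hφ : IsRepulsivePotential φ) (hd : 0 < d)
    (hN : N ≠ 0) {r : ℝ} (hr : 0 < r) {ρ : Measure (Space d)} [IsProbabilityMeasure ρ]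
    (hρ : ∀ x, ρ (Metric.ball x r) ≤ (8 * N : ℝ≥0∞)⁻¹) : transportCost N φ ρ ≠ ⊤ := by
  obtain ⟨ρ₁, h₁, hb, ht⟩ := exists_spread_measure hφ hd hN hr
  have h₁' : IsProbabilityMeasure (0 + ρ₁) := by rwa [zero_add]
  have h₂' : IsProbabilityMeasure (0 + ρ) := by rwa [zero_add]
  have h := transportCost_le_add (μ := 0) (σ₁ := ρ₁) (σ₂ := ρ) hφ hN hr
    (by simpa using hb) (by simpa using hρ)
  rw [zero_add, zero_add] at h
  refine ne_top_of_le_ne_top ?_ h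
  rw [measure_univ]
  finiteness

open scoped Convolution in
/-- The pairing of a translation difference of `u` with a test function is controlled by the
weak gradient. -/
theorem norm_integral_mul_translate_sub_le {d : ℕ} {u : Space d → ℝ} {G : Space d → Space d}
    (hG : IsWeakGradient u G) (hG2 : MemLp G 2 volume) {ψ : Space d → ℝ}
    (hψ : ContDiff ℝ ∞ ψ) (hψc : HasCompactSupport ψ) (h : Space d) :
    ‖(∫ x, u x * ψ (x - h)) - ∫ x, u x * ψ x‖ ≤
      ‖h‖ * (eLpNorm G 2 volume).toReal * (eLpNorm ψ 2 volume).toReal := by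
  set L := ContinuousLinearMap.mul ℝ ℝ with hL
  set χ : Space d → ℝ := fun y => ψ (-y) with hχ
  have hχs : ContDiff ℝ ∞ χ := hψ.comp contDiff_neg
  have hχc : HasCompactSupport χ := hψc.comp_homeomorph (Homeomorph.neg _)
  have hconv : ∀ z, (u ⋆[L, volume] χ) z = ∫ x, u x * ψ (x - z) := by
    intro z
    simp [convolution_def, hL, hχ]
  have hd : ∀ z, HasFDerivAt (u ⋆[L, volume] χ)
      ((u ⋆[L.precompR (Space d), volume] fderiv ℝ χ) z) z := fun z =>
    hχc.hasFDerivAt_convolution_right L hG.locallyIntegrable (hχs.of_le (by norm_cast)) z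
  have hval : ∀ z v, (u ⋆[L.precompR (Space d), volume] fderiv ℝ χ) z v =
      ∫ x, ψ (x - z) * inner ℝ (G x) v := by
    intro z v
    rw [convolution_precompR_apply L hG.locallyIntegrable (hχc.fderiv ℝ)
      (hχs.continuous_fderiv (by simp)), convolution_def]
    have hη : ContDiff ℝ ∞ fun x => ψ (x - z) := hψ.comp (contDiff_id.sub contDiff_const)
    have hηc : HasCompactSupport fun x => ψ (x - z) := by
      have := hψc.comp_homeomorph (Homeomorph.addRight (-z))
      simp only [sub_eq_add_neg]
      exact this
    rw [← neg_eq_iff_eq_neg.2 (hG.integral_eq _ hη hηc v), ← integral_neg]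
    refine integral_congr_ae (Eventually.of_forall fun x => ?_)
    have hψd : DifferentiableAt ℝ ψ (x - z) := hψ.differentiable (by simp) _
    have e1 : fderiv ℝ χ (z - x) v = -fderiv ℝ ψ (x - z) v := by
      have h1 : HasFDerivAt ψ (fderiv ℝ ψ (x - z)) (-(z - x)) := by
        rw [neg_sub]
        exact hψd.hasFDerivAt
      have h2 := h1.comp (z - x) (hasFDerivAt_id (z - x)).neg
      have h3 : fderiv ℝ χ (z - x) = _ := h2.fderiv
      rw [h3]
      simp
    have e2 : fderiv ℝ (fun x => ψ (x - z)) x v = fderiv ℝ ψ (x - z) v := by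
      rw [fderiv_comp_sub]
    simp only [hL, ContinuousLinearMap.mul_apply', e1, e2]
    ring
  have hbound : ∀ z, ‖∫ x, ψ (x - z) * inner ℝ (G x) h‖ ≤
      ‖h‖ * (eLpNorm G 2 volume).toReal * (eLpNorm ψ 2 volume).toReal := by
    intro z
    have hη : MemLp (fun x => ψ (x - z)) 2 volume :=
      (hψ.continuous.memLp_of_hasCompactSupport hψc).comp_measurePreserving
        (measurePreserving_sub_right volume z)
    have hη' : eLpNorm (fun x => ψ (x - z)) 2 volume = eLpNorm ψ 2 volume :=
      eLpNorm_comp_measurePreserving hψ.continuous.aestronglyMeasurable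
        (measurePreserving_sub_right volume z)
    have h1 := eLpNorm_le_eLpNorm_mul_eLpNorm_of_nnnorm (p := 2) (q := 2) (r := 1) hη.1 hG2.1
      (fun a y => a * inner ℝ y h) ‖h‖₊ (Eventually.of_forall fun x => by
        rw [nnnorm_mul, mul_assoc, mul_left_comm]
        gcongr
        rw [mul_comm]
        exact nnnorm_inner_le_nnnorm _ _)
    have h2 : ‖∫ x, ψ (x - z) * inner ℝ (G x) h‖ₑ ≤
        ‖h‖ₑ * eLpNorm ψ 2 volume * eLpNorm G 2 volume := by
      refine (enorm_integral_le_lintegral_enorm _).trans ?_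
      rw [← eLpNorm_one_eq_lintegral_enorm, ← hη']
      exact h1
    have hfin : ‖h‖ₑ * eLpNorm ψ 2 volume * eLpNorm G 2 volume ≠ ⊤ :=
      ENNReal.mul_ne_top (ENNReal.mul_ne_top enorm_ne_top (hη' ▸ hη.2.ne)) hG2.2.ne
    have h3 := ENNReal.toReal_mono hfin h2
    rw [ENNReal.toReal_mul, ENNReal.toReal_mul, toReal_enorm, toReal_enorm] at h3
    linarith
  have hline : ∀ t : ℝ, HasDerivAt (fun t : ℝ => (u ⋆[L, volume] χ) (t • h))
      (∫ x, ψ (x - t • h) * inner ℝ (G x) h) t := by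
    intro t
    rw [← hval]
    have := (hd (t • h)).comp_hasDerivAt t ((hasDerivAt_id t).smul_const h)
    simpa [Function.comp_def] using this
  have hmv := Convex.norm_image_sub_le_of_norm_hasDerivWithin_le
    (s := univ) (x := (0 : ℝ)) (y := 1)
    (fun t _ => (hline t).hasDerivWithinAt) (fun t _ => hbound (t • h)) convex_univ
    (mem_univ _) (mem_univ _)
  simpa [hconv] using hmv

/-- The `L²` modulus of continuity of an `H¹` function. -/
theorem eLpNorm_translate_sub_le {d : ℕ} {u : Space d → ℝ} {G : Space d → Space d}
    (hu : MemLp u 2 volume) (hG : IsWeakGradient u G) (hG2 : MemLp G 2 volume) (h : Space d) :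
    eLpNorm (fun x => u (x + h) - u x) 2 volume ≤ ‖h‖ₑ * eLpNorm G 2 volume := by
  have hut : MemLp (fun x => u (x + h)) 2 volume :=
    hu.comp_measurePreserving (measurePreserving_add_right volume h)
  have hD : MemLp (fun x => u (x + h) - u x) 2 volume := hut.sub hu
  set C := ‖h‖ * (eLpNorm G 2 volume).toReal with hC
  have key : ∀ f : Lp ℝ 2 (volume : Measure (Space d)), ‖inner ℝ f hD.toLp‖ ≤ C * ‖f‖ := by
    intro f
    refine (Lp.dense_hasCompactSupport_contDiff (F := ℝ) (μ := (volume : Measure (Space d)))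
      (p := 2) (by simp)).induction
      (P := fun f => ‖inner ℝ f hD.toLp‖ ≤ C * ‖f‖) ?_
      (isClosed_le (by fun_prop) (by fun_prop)) f
    rintro f ⟨ψ, hfψ, hψc, hψ⟩
    have hψL : MemLp ψ 2 volume := hψ.continuous.memLp_of_hasCompactSupport hψc
    have e1 : inner ℝ f hD.toLp = (∫ x, u x * ψ (x - h)) - ∫ x, u x * ψ x := by
      have e2 : ∫ x, u x * ψ (x - h) = ∫ x, u (x + h) * ψ x := by
        rw [← integral_add_right_eq_self _ h]
        simp
      have i1 : Integrable (fun x => u (x + h) * ψ x) volume := hut.integrable_mul hψL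
      have i2 : Integrable (fun x => u x * ψ x) volume := hu.integrable_mul hψL
      rw [L2.inner_def, e2, ← integral_sub i1 i2]
      refine integral_congr_ae ?_
      filter_upwards [hfψ, hD.coeFn_toLp] with x h1 h2
      rw [h1, h2, ← sub_mul]
      rfl
    rw [e1, Lp.norm_def, eLpNorm_congr_ae hfψ]
    exact norm_integral_mul_translate_sub_le hG hG2 hψ hψc h
  have h1 := key hD.toLp
  rw [real_inner_self_eq_norm_sq, Real.norm_of_nonneg (sq_nonneg _), sq] at h1
  have hC0 : 0 ≤ C := by positivity
  have h2 : ‖hD.toLp‖ ≤ C := by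
    by_contra hlt
    push Not at hlt
    nlinarith [mul_lt_mul_of_pos_right hlt (hC0.trans_lt hlt)]
  rw [Lp.norm_toLp] at h2
  rw [← ENNReal.toReal_le_toReal hD.2.ne (ENNReal.mul_ne_top enorm_ne_top hG2.2.ne),
    ENNReal.toReal_mul, toReal_enorm]
  exact h2

theorem isProbabilityMeasure_densityMeasure {d : ℕ} {ρ : Lp ℝ 1 (volume : Measure (Space d))}
    (hρ : ρ ∈ probDensities d) : IsProbabilityMeasure (densityMeasure ρ) := by
  refine ⟨?_⟩
  rw [densityMeasure, withDensity_apply _ .univ, setLIntegral_univ,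
    ← ofReal_integral_eq_lintegral_ofReal (L1.integrable_coeFn ρ) ((Lp.coeFn_nonneg ρ).2 hρ.1),
    hρ.2, ENNReal.ofReal_one]

theorem densityCost_le_add {d N : ℕ} {φ : ℝ → ℝ} (hφ : IsRepulsivePotential φ)
    (hN : N ≠ 0) {r : ℝ} (hr : 0 < r) {ρ₁ ρ₂ : Lp ℝ 1 (volume : Measure (Space d))}
    (h₁ : ρ₁ ∈ probDensities d) (h₂ : ρ₂ ∈ probDensities d)
    (hρ₁ : ∀ x, densityMeasure ρ₁ (Metric.ball x r) ≤ (8 * N : ℝ≥0∞)⁻¹)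
    (hρ₂ : ∀ x, densityMeasure ρ₂ (Metric.ball x r) ≤ (8 * N : ℝ≥0∞)⁻¹) :
    densityCost N φ ρ₂ ≤
      densityCost N φ ρ₁ + 2 * N ^ 4 * ENNReal.ofReal (φ r) * edist ρ₁ ρ₂ := by
  have hp₁ := isProbabilityMeasure_densityMeasure h₁
  have hp₂ := isProbabilityMeasure_densityMeasure h₂
  set A : Space d → ℝ≥0∞ := fun x => ENNReal.ofReal (ρ₁ x) with hA
  set B : Space d → ℝ≥0∞ := fun x => ENNReal.ofReal (ρ₂ x) with hB
  have hAm : Measurable A := (Lp.stronglyMeasurable ρ₁).measurable.ennreal_ofReal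
  have hBm : Measurable B := (Lp.stronglyMeasurable ρ₂).measurable.ennreal_ofReal
  have e₁ : densityMeasure ρ₁ = volume.withDensity (fun x => min (A x) (B x)) +
      volume.withDensity (fun x => A x - B x) := by
    rw [← withDensity_add_left (hAm.min hBm), densityMeasure]
    congr 1
    funext x
    change A x = min (A x) (B x) + (A x - B x)
    rcases le_total (A x) (B x) with h | h
    · rw [min_eq_left h, tsub_eq_zero_of_le h, add_zero]
    · rw [min_eq_right h, add_tsub_cancel_of_le h]
  have e₂ : densityMeasure ρ₂ = volume.withDensity (fun x => min (A x) (B x)) +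
      volume.withDensity (fun x => B x - A x) := by
    rw [← withDensity_add_left (hAm.min hBm), densityMeasure]
    congr 1
    funext x
    change B x = min (A x) (B x) + (B x - A x)
    rcases le_total (A x) (B x) with h | h
    · rw [min_eq_left h, add_tsub_cancel_of_le h]
    · rw [min_eq_right h, tsub_eq_zero_of_le h, add_zero]
  rw [densityCost, densityCost]
  rw [e₁] at hp₁ hρ₁ ⊢
  rw [e₂] at hp₂ hρ₂ ⊢
  refine (transportCost_le_add hφ hN hr hρ₁ hρ₂).trans ?_
  gcongr
  rw [withDensity_apply _ .univ, setLIntegral_univ, Lp.edist_def, eLpNorm_one_eq_lintegral_enorm]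
  refine lintegral_mono fun x => ?_
  rw [hA, hB, Pi.sub_apply, Real.enorm_eq_ofReal_abs]
  rw [tsub_le_iff_right]
  refine (ENNReal.ofReal_le_ofReal ?_).trans ENNReal.ofReal_add_le
  linarith [le_abs_self (ρ₁ x - ρ₂ x)]

theorem lipschitzOnWith_densityCost {d N : ℕ} {φ : ℝ → ℝ} (hφ : IsRepulsivePotential φ)
    (hd : 0 < d) (hN : N ≠ 0) {r : ℝ} (hr : 0 < r)
    {S : Set (Lp ℝ 1 (volume : Measure (Space d)))} (hS : S ⊆ probDensities d)
    (hSr : ∀ ρ ∈ S, ∀ x, densityMeasure ρ (Metric.ball x r) ≤ (8 * N : ℝ≥0∞)⁻¹) :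
    (∀ ρ ∈ S, densityCost N φ ρ ≠ ⊤) ∧
      ∃ K : ℝ≥0, LipschitzOnWith K (fun ρ => (densityCost N φ ρ).toReal) S := by
  have hfin : ∀ ρ ∈ S, densityCost N φ ρ ≠ ⊤ := fun ρ hρ => by
    have := isProbabilityMeasure_densityMeasure (hS hρ)
    exact transportCost_ne_top hφ hd hN hr (hSr ρ hρ)
  refine ⟨hfin, (2 * N ^ 4 * ENNReal.ofReal (φ r)).toNNReal, ?_⟩
  refine LipschitzOnWith.of_le_add_mul _ fun ρ₂ h₂ ρ₁ h₁ => ?_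
  have h := densityCost_le_add hφ hN hr (hS h₁) (hS h₂) (hSr _ h₁) (hSr _ h₂)
  have hK : (2 * N ^ 4 * ENNReal.ofReal (φ r) * edist ρ₁ ρ₂ : ℝ≥0∞) ≠ ⊤ :=
    ENNReal.mul_ne_top (by finiteness) (edist_ne_top _ _)
  have h' := ENNReal.toReal_mono (ENNReal.add_ne_top.2 ⟨hfin _ h₁, hK⟩) h
  rw [ENNReal.toReal_add (hfin _ h₁) hK, ENNReal.toReal_mul, edist_comm, ← dist_edist] at h'
  exact h'

theorem exists_densityMeasure_ball_le_of_eLpNorm {d : ℕ} (hd : 0 < d) {p : ℝ≥0∞} (hp : 1 < p)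
    (M : ℝ≥0) {ε : ℝ≥0∞} (hε : ε ≠ 0) :
    ∃ r : ℝ, 0 < r ∧ ∀ ρ : Lp ℝ 1 (volume : Measure (Space d)), eLpNorm ρ p volume ≤ M →
      ∀ x, densityMeasure ρ (Metric.ball x r) ≤ ε := by
  set s : ℝ := 1 / (1 : ℝ≥0∞).toReal - 1 / p.toReal with hs
  have hs0 : 0 < s := by
    rw [hs, ENNReal.toReal_one, div_one, sub_pos]
    by_cases hpt : p = ⊤
    · simp [hpt]
    · have h1 : 1 < p.toReal := by
        rw [← ENNReal.toReal_one]
        exact (ENNReal.toReal_lt_toReal (by simp) hpt).2 hp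
      rw [div_lt_one (by linarith)]
      exact h1
  have hlim : Tendsto (fun r : ℝ => (M : ℝ≥0∞) *
      (ENNReal.ofReal (r ^ d) * volume (Metric.ball (0 : Space d) 1)) ^ s) (𝓝[>] 0) (𝓝 0) := by
    have h1 : Tendsto (fun r : ℝ => ENNReal.ofReal (r ^ d)) (𝓝[>] 0) (𝓝 0) := by
      have h0 : ENNReal.ofReal ((0 : ℝ) ^ d) = 0 := by simp [hd.ne']
      rw [← h0]
      exact ((ENNReal.continuous_ofReal.comp (continuous_pow d)).tendsto 0).mono_left
        nhdsWithin_le_nhds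
    have h2 := ENNReal.Tendsto.mul_const (b := volume (Metric.ball (0 : Space d) 1)) h1
      (Or.inr measure_ball_lt_top.ne)
    have h3 := ENNReal.Tendsto.const_mul (a := (M : ℝ≥0∞))
      ((ENNReal.continuous_rpow_const (y := s)).continuousAt.tendsto.comp h2)
      (Or.inr ENNReal.coe_ne_top)
    simpa [ENNReal.zero_rpow_of_pos hs0] using h3
  obtain ⟨r, hr, hr0⟩ := ((hlim.eventually_lt_const (pos_iff_ne_zero.2 hε)).and
    self_mem_nhdsWithin).exists
  refine ⟨r, hr0, fun ρ hρ x => ?_⟩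
  rw [densityMeasure, withDensity_apply _ Metric.isOpen_ball.measurableSet]
  calc ∫⁻ y in Metric.ball x r, ENNReal.ofReal (ρ y)
      ≤ ∫⁻ y in Metric.ball x r, ‖ρ y‖ₑ := lintegral_mono fun y => Real.ofReal_le_enorm _
    _ = eLpNorm ρ 1 (volume.restrict (Metric.ball x r)) :=
      eLpNorm_one_eq_lintegral_enorm.symm
    _ ≤ eLpNorm ρ p (volume.restrict (Metric.ball x r)) *
        (volume.restrict (Metric.ball x r)) univ ^ s :=
      eLpNorm_le_eLpNorm_mul_rpow_measure_univ hp.le (Lp.aestronglyMeasurable ρ).restrict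
    _ ≤ M * (ENNReal.ofReal (r ^ d) * volume (Metric.ball (0 : Space d) 1)) ^ s := by
      rw [Measure.restrict_apply_univ, Measure.addHaar_ball_of_pos _ _ hr0,
        finrank_euclideanSpace, Fintype.card_fin]
      gcongr
      exact (eLpNorm_mono_measure _ Measure.restrict_le_self).trans hρ
    _ ≤ ε := hr.le

theorem densityMeasure_apply_eq_sq {d : ℕ} {ρ : Lp ℝ 1 (volume : Measure (Space d))}
    (hρ : 0 ≤ ρ) {A : Set (Space d)} (hA : MeasurableSet A) :
    densityMeasure ρ A = eLpNorm (fun x => √(ρ x)) 2 (volume.restrict A) ^ 2 := by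
  have h := eLpNorm_nnreal_pow_eq_lintegral (f := fun x => √(ρ x)) (p := 2)
    (μ := volume.restrict A) (by simp)
  rw [densityMeasure, withDensity_apply _ hA]
  refine Eq.trans ?_ (h.symm.trans ?_)
  · refine lintegral_congr_ae (ae_restrict_of_ae ?_)
    filter_upwards [(Lp.coeFn_nonneg ρ).2 hρ] with x hx
    rw [Real.enorm_of_nonneg (Real.sqrt_nonneg _)]
    simp only [NNReal.coe_ofNat, ENNReal.rpow_ofNat]
    rw [← ENNReal.ofReal_pow (Real.sqrt_nonneg _), Real.sq_sqrt hx]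
  · simp

theorem exists_densityMeasure_ball_le_of_weakGradient {d : ℕ} (hd : 0 < d) (M : ℝ≥0) {K : ℕ}
    (hK : K ≠ 0) :
    ∃ r : ℝ, 0 < r ∧ ∀ ρ ∈ probDensities d, ∀ G, MemLp (fun x => √(ρ x)) 2 volume →
      IsWeakGradient (fun x => √(ρ x)) G → MemLp G 2 volume → eLpNorm G 2 volume ≤ M →
      ∀ x, densityMeasure ρ (Metric.ball x r) ≤ (K : ℝ≥0∞)⁻¹ := by
  set k : ℕ := (2 * K) ^ 2 with hk
  have hk0 : k ≠ 0 := by simp [hk, hK]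
  have hKp : (0 : ℝ) < K := by positivity
  have hkp : (0 : ℝ) < k := by positivity
  set r : ℝ := (4 * k * K * (M + 1))⁻¹ with hr
  have hr0 : 0 < r := by positivity
  refine ⟨r, hr0, fun ρ hρ G hu hG hG2 hGM x => ?_⟩
  have hprob := isProbabilityMeasure_densityMeasure hρ
  set h : Fin k → Space d := fun i => PiLp.single 2 ⟨0, hd⟩ (2 * r * ((i : ℕ) : ℝ)) with hh
  have hdist : ∀ i j, i ≠ j → 2 * r ≤ dist (h i) (h j) := fun i j hij =>
    two_mul_le_dist_single _ hr0 (Fin.val_ne_of_ne hij)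
  obtain ⟨i, hi⟩ : ∃ i, densityMeasure ρ (Metric.ball (x + h i) r) ≤ (k : ℝ≥0∞)⁻¹ := by
    by_contra! hcon
    have : Nonempty (Fin k) := ⟨⟨0, Nat.pos_of_ne_zero hk0⟩⟩
    have h1 : ∑ i : Fin k, (k : ℝ≥0∞)⁻¹ < ∑ i, densityMeasure ρ (Metric.ball (x + h i) r) :=
      ENNReal.sum_lt_sum_of_nonempty Finset.univ_nonempty fun i _ => hcon i
    have h2 : ∑ i, densityMeasure ρ (Metric.ball (x + h i) r) ≤ 1 := by
      rw [← tsum_fintype (L := SummationFilter.unconditional _), ← measure_iUnion _ fun i => Metric.isOpen_ball.measurableSet]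
      · exact prob_le_one
      · intro i j hij
        refine Metric.ball_disjoint_ball ?_
        rw [dist_add_left]
        linarith [hdist i j hij]
    have h3 : ∑ i : Fin k, (k : ℝ≥0∞)⁻¹ = 1 := by
      simpa using ENNReal.mul_inv_cancel (by simpa using hk0) (ENNReal.natCast_ne_top k)
    exact absurd (h3 ▸ h1) h2.not_gt
  have hnorm : ‖h i‖ₑ * eLpNorm G 2 volume ≤ (2 * K : ℝ≥0∞)⁻¹ := by
    have h1 : ‖h i‖ * M ≤ (2 * K : ℝ)⁻¹ := by
      have h2 : ‖h i‖ ≤ 2 * r * k := by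
        rw [hh, PiLp.norm_single, Real.norm_of_nonneg (by positivity)]
        gcongr
        exact i.2.le
      calc ‖h i‖ * M ≤ 2 * r * k * (M + 1) := by
            gcongr
            simp
        _ = (2 * K : ℝ)⁻¹ := by
            rw [hr]
            have : (M : ℝ) + 1 ≠ 0 := by positivity
            field_simp
            norm_num
    calc ‖h i‖ₑ * eLpNorm G 2 volume ≤ ‖h i‖ₑ * M := by gcongr
      _ = ENNReal.ofReal (‖h i‖ * M) := by
        rw [ENNReal.ofReal_mul (norm_nonneg _), ofReal_norm, ENNReal.ofReal_coe_nnreal]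
      _ ≤ ENNReal.ofReal (2 * K : ℝ)⁻¹ := ENNReal.ofReal_le_ofReal h1
      _ = (2 * K : ℝ≥0∞)⁻¹ := by
        rw [ENNReal.ofReal_inv_of_pos (by positivity), ENNReal.ofReal_mul (by norm_num)]
        simp
  set u : Space d → ℝ := fun x => √(ρ x) with hu_def
  have hshift : eLpNorm (fun y => u (y + h i)) 2 (volume.restrict (Metric.ball x r)) =
      eLpNorm u 2 (volume.restrict (Metric.ball (x + h i) r)) := by
    have hmp := (measurePreserving_add_right (volume : Measure (Space d)) (h i)).restrict_preimage
      (s := Metric.ball (x + h i) r) Metric.isOpen_ball.measurableSet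
    have hpre : (fun y => y + h i) ⁻¹' Metric.ball (x + h i) r = Metric.ball x r := by
      ext y
      simp
    rw [hpre] at hmp
    exact eLpNorm_comp_measurePreserving hu.1.restrict hmp
  have hshift_le : eLpNorm u 2 (volume.restrict (Metric.ball (x + h i) r)) ≤
      (2 * K : ℝ≥0∞)⁻¹ := by
    rw [densityMeasure_apply_eq_sq hρ.1 Metric.isOpen_ball.measurableSet, hk] at hi
    push_cast at hi
    rw [ENNReal.inv_pow] at hi
    exact (ENNReal.pow_le_pow_left_iff two_ne_zero).1 hi
  have hut : AEStronglyMeasurable (fun y => u (y + h i)) volume :=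
    (hu.comp_measurePreserving (measurePreserving_add_right volume (h i))).1
  have hmain : eLpNorm u 2 (volume.restrict (Metric.ball x r)) ≤ (K : ℝ≥0∞)⁻¹ := by
    calc eLpNorm u 2 (volume.restrict (Metric.ball x r))
        = eLpNorm ((fun y => u (y + h i)) - fun y => u (y + h i) - u y) 2
            (volume.restrict (Metric.ball x r)) := by
          congr 1
          funext y
          simp
      _ ≤ eLpNorm (fun y => u (y + h i)) 2 (volume.restrict (Metric.ball x r)) +
            eLpNorm (fun y => u (y + h i) - u y) 2 (volume.restrict (Metric.ball x r)) :=
          eLpNorm_sub_le hut.restrict (hut.sub hu.1).restrict (by norm_num)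
      _ ≤ (2 * K : ℝ≥0∞)⁻¹ + (2 * K : ℝ≥0∞)⁻¹ := by
          refine add_le_add (hshift.trans_le hshift_le) ?_
          exact ((eLpNorm_mono_measure _ Measure.restrict_le_self).trans
            (eLpNorm_translate_sub_le hu hG hG2 (h i))).trans hnorm
      _ = (K : ℝ≥0∞)⁻¹ := by
          rw [← two_mul, ENNReal.mul_inv (by simp) (by simp), ← mul_assoc,
            ENNReal.mul_inv_cancel (by simp) (by simp), one_mul]
  rw [densityMeasure_apply_eq_sq hρ.1 Metric.isOpen_ball.measurableSet]
  have hK1 : (K : ℝ≥0∞)⁻¹ ≤ 1 := by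
    rw [ENNReal.inv_le_one]
    exact_mod_cast Nat.one_le_iff_ne_zero.2 hK
  calc _ ≤ ((K : ℝ≥0∞)⁻¹) ^ 2 := by gcongr
    _ ≤ (K : ℝ≥0∞)⁻¹ := pow_le_of_le_one zero_le hK1 two_ne_zero

theorem exists_weakGradient_of_eH1Norm_le {d : ℕ} {u : Space d → ℝ} {M : ℝ≥0}
    (h : eH1Norm u ≤ M) :
    ∃ G, IsWeakGradient u G ∧ MemLp G 2 volume ∧ eLpNorm G 2 volume ≤ (M + 1 : ℝ≥0) := by
  have h1 : eH1Norm u < (M + 1 : ℝ≥0) :=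
    h.trans_lt (ENNReal.coe_lt_coe.2 (lt_add_one M))
  simp only [eH1Norm, iInf_lt_iff] at h1
  obtain ⟨G, hG, hlt⟩ := h1
  have h2 : eLpNorm G 2 volume ≤ (M + 1 : ℝ≥0) := by
    refine le_trans ?_ hlt.le
    calc eLpNorm G 2 volume = (eLpNorm G 2 volume ^ 2) ^ (1 / 2 : ℝ) := by
          rw [← ENNReal.rpow_natCast, ← ENNReal.rpow_mul]
          norm_num
      _ ≤ _ := by
          gcongr
          exact le_add_self
  exact ⟨G, hG, ⟨hG.locallyIntegrable_grad.aestronglyMeasurable,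
    h2.trans_lt ENNReal.coe_lt_top⟩, h2⟩

end RepulsiveTransport

theorem mainTheorem8 (N : ℕ) (hN : 1 < N) (φ : ℝ → ℝ)
    (hφ : RepulsiveTransport.IsRepulsivePotential φ) :
    (∀ d : ℕ, 0 < d → ∀ p : ℝ≥0∞, 1 < p →
      ∀ S : Set (Lp ℝ 1 (volume : Measure (RepulsiveTransport.Space d))),
        S ⊆ RepulsiveTransport.probDensities d →
        (∃ M : ℝ≥0, ∀ ρ ∈ S, eLpNorm ρ p volume ≤ M) →
        (∀ ρ ∈ S, RepulsiveTransport.densityCost N φ ρ ≠ ⊤) ∧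
        ∃ K : ℝ≥0,
          LipschitzOnWith K (fun ρ => (RepulsiveTransport.densityCost N φ ρ).toReal) S) ∧
    (∀ S : Set (Lp ℝ 1 (volume : Measure (RepulsiveTransport.Space 3))),
        S ⊆ RepulsiveTransport.dftDensities →
        (∃ M : ℝ≥0, ∀ ρ ∈ S, RepulsiveTransport.eH1Norm (fun x => √(ρ x)) ≤ M) →
        (∀ ρ ∈ S, RepulsiveTransport.densityCost N φ ρ ≠ ⊤) ∧
        ∃ K : ℝ≥0,
          LipschitzOnWith K (fun ρ => (RepulsiveTransport.densityCost N φ ρ).toReal) S) := by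
  have hN0 : N ≠ 0 := by omega
  refine ⟨fun d hd p hp S hS ⟨M, hM⟩ => ?_, fun S hS ⟨M, hM⟩ => ?_⟩
  · obtain ⟨r, hr, h⟩ := RepulsiveTransport.exists_densityMeasure_ball_le_of_eLpNorm hd hp M
      (ε := (8 * N : ℝ≥0∞)⁻¹) (ENNReal.inv_ne_zero.2 (by finiteness))
    exact RepulsiveTransport.lipschitzOnWith_densityCost hφ hd hN0 hr hS
      fun ρ hρ => h ρ (hM ρ hρ)
  · have hS' : S ⊆ RepulsiveTransport.probDensities 3 := fun ρ hρ =>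
      ⟨(hS hρ).1, (hS hρ).2.2⟩
    obtain ⟨r, hr, h⟩ := RepulsiveTransport.exists_densityMeasure_ball_le_of_weakGradient
      (d := 3) (by norm_num) (M + 1) (K := 8 * N) (by omega)
    refine RepulsiveTransport.lipschitzOnWith_densityCost hφ (by norm_num) hN0 hr hS'
      fun ρ hρ x => ?_
    obtain ⟨G, hG, hG2, hGM⟩ := RepulsiveTransport.exists_weakGradient_of_eH1Norm_le (hM ρ hρ)
    exact_mod_cast h ρ (hS' hρ) G (hS hρ).2.1.1 hG hG2 hGM x
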